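/- Let $\mathbb{R}_{\max}=\mathbb{R}\cup\{-\infty\}$ be the max-plus semiring (addition $\max$, multiplication $+$), let $n\ge 1$ and $[n]=\{1,\dots,n\}$. A \emph{real polyhedral cone} is a set $$\mathcal{C}=\Bigl\{x\in\mathbb{R}_{\max}^n \;\Big|\; x_i=\max_{1\le r\le p}(\lambda_r+v^r_i)\ (i\in[n])\ \text{for some } \lambda_1,\dots,\lambda_p\in\mathbb{R}_{\max}\Bigr\}$$ with $p\ge 1$ and generators $v^1,\dots,v^p\in\mathbb{R}^n$; it is identified with the image of its real vectors in $\mathbb{P}^{n-1}=\mathbb{R}^n/(1,\dots,1)\mathbb{R}$. A \emph{tropical half-space with apex} $a\in\mathbb{P}^{n-1}$ is a set $$\mathcal{H}(a,I)=\Bigl\{x\in\mathbb{R}_{\max}^n \;\Big|\; \max_{i\in I}(x_i-a_i)\ge\max_{j\in[n]\setminus I}(x_j-a_j)\Bigr\}$$ with $\emptyset\ne I\subsetneq[n]$ (it does not depend on the representative of $a$). A finite set $\Gamma$ of tropical half-spaces with apices in $\mathcal{C}$ is a \emph{non-redundant external representation} of $\mathcal{C}$ if $\mathcal{C}=\bigcap_{\mathcal{H}\in\Gamma}\mathcal{H}$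 and, for every $\mathcal{H}\in\Gamma$, the intersection of the members of $\Gamma\setminus\{\mathcal{H}\}$ is not contained in $\mathcal{H}$ (the empty intersection is $\mathbb{R}_{\max}^n$). \textbf{Theorem.} For each real polyhedral cone $\mathcal{C}\subset\mathbb{P}^{n-1}$ there exist a finite subset $\mathcal{A}$ of $\mathcal{C}$ and, for each $a\in\mathcal{A}$, a non-empty collection $\mathcal{C}_a$ of pairwise disjoint non-empty sets of tropical half-spaces with apex $a$, satisfying the following property: a finite set $\Gamma$ of tropical half-spaces with apices in $\mathcal{C}$ is a non-redundant external representation of $\mathcal{C}$ if and only if it is composed of precisely one half-space in each set of the collection $\mathcal{C}_a$ for each $a\in\mathcal{A}$, that is, every member of $\Gamma$ belongs to some set of some $\mathcal{C}_a$ with $a\in\mathcal{A}$, and $\Gamma$ contains exactly one element of each set of $\mathcal{C}_a$, for every $a\in\mathcal{A}$. In particular, such non-redundant external representations exist, and they all involve exactly the apices in $\mathcal{A}$. -/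

import Mathlib

namespace TropicalCone

/-- Vectors over the max-plus semiring `ℝ ∪ {-∞}`; the bottom element of `WithBot ℝ` is `-∞`,
tropical addition is `max` and tropical multiplication is `+` (with `⊥ + t = ⊥`). -/
abbrev MaxPlusVec (n : ℕ) : Type := Fin n → WithBot ℝ

/-- The real projective space `ℝⁿ / (1, …, 1)ℝ`. -/
abbrev ProjSpace (n : ℕ) : Type :=
  (Fin n → ℝ) ⧸ Submodule.span ℝ {(fun _ => 1 : Fin n → ℝ)}

/-- The class of a real vector in the real projective space. -/
def toProj {n : ℕ} (x : Fin n → ℝ) : ProjSpace n :=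
  Submodule.Quotient.mk x

/-- A real vector, seen as a max-plus vector. -/
def ofReal {n : ℕ} (x : Fin n → ℝ) : MaxPlusVec n :=
  fun i => (x i : WithBot ℝ)

/-- The tropical cone generated by `v 0, …, v (p - 1)`: all tropical linear combinations
`i ↦ max_r (c r + v r i)` with coefficients `c r` in `ℝ ∪ {-∞}`. -/
def tropicalSpan {n p : ℕ} (v : Fin p → MaxPlusVec n) : Set (MaxPlusVec n) :=
  {x | ∃ c : Fin p → WithBot ℝ, ∀ i, x i = Finset.univ.sup (fun r => c r + v r i)}

/-- A real polyhedral cone: a tropical cone generated by finitely many, and at least one,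
vectors of `ℝⁿ`. -/
def IsRealPolyhedralCone {n : ℕ} (C : Set (MaxPlusVec n)) : Prop :=
  ∃ (p : ℕ) (v : Fin p → Fin n → ℝ), 0 < p ∧ C = tropicalSpan (fun r => ofReal (v r))

/-- The image in the real projective space of (the real vectors of) a tropical cone. -/
def projImage {n : ℕ} (C : Set (MaxPlusVec n)) : Set (ProjSpace n) :=
  {a | ∃ x : Fin n → ℝ, ofReal x ∈ C ∧ toProj x = a}

/-- The set of `x` with `max_{i ∈ I} (x i - a i) ≥ max_{j ∉ I} (x j - a j)`. -/
def halfSpace {n : ℕ} (a : Fin n → ℝ) (I : Finset (Fin n)) : Set (MaxPlusVec n) :=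
  {x | Iᶜ.sup (fun j => x j + ((-a j : ℝ) : WithBot ℝ)) ≤
    I.sup (fun i => x i + ((-a i : ℝ) : WithBot ℝ))}

/-- `H` is a (non-degenerate) tropical half-space with apex `a`. -/
def IsHalfSpaceWithApex {n : ℕ} (H : Set (MaxPlusVec n)) (a : ProjSpace n) : Prop :=
  ∃ (x : Fin n → ℝ) (I : Finset (Fin n)),
    toProj x = a ∧ I.Nonempty ∧ Iᶜ.Nonempty ∧ H = halfSpace x I

/-- `H` is a (non-degenerate) tropical half-space whose apex belongs to `C`. -/
def IsHalfSpaceWithApexIn {n : ℕ} (C H : Set (MaxPlusVec n)) : Prop :=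
  ∃ a ∈ projImage C, IsHalfSpaceWithApex H a

/-- `H` is redundant with respect to `Γ`: it contains the intersection of the members of `Γ`. -/
def IsRedundant {n : ℕ} (H : Set (MaxPlusVec n)) (Γ : Set (Set (MaxPlusVec n))) : Prop :=
  ⋂₀ Γ ⊆ H

/-- The family `Γ` represents `C` externally, and none of its members is redundant with respect
to the others. -/
def IsNonRedundantRepresentation {n : ℕ} (C : Set (MaxPlusVec n))
    (Γ : Set (Set (MaxPlusVec n))) : Prop :=
  C = ⋂₀ Γ ∧ ∀ H ∈ Γ, ¬ IsRedundant H (Γ \ {H})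

/-- `Γ` is composed of precisely one half-space in each set of the collection `𝒞 a`,
for each `a ∈ A` (and of nothing else). -/
def IsComposedOfOneInEach {n : ℕ} (A : Set (ProjSpace n))
    (𝒞 : ProjSpace n → Set (Set (Set (MaxPlusVec n)))) (Γ : Set (Set (MaxPlusVec n))) : Prop :=
  (∀ H ∈ Γ, ∃ a ∈ A, ∃ S ∈ 𝒞 a, H ∈ S) ∧
    ∀ a ∈ A, ∀ S ∈ 𝒞 a, ∃! H, H ∈ Γ ∧ H ∈ S

end TropicalCone

namespace TropicalCone

/-! Everything is read off maximisers of coordinate differences. Whether a half-space with apex in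
the cone follows from finitely many half-spaces containing the cone is a local question at its apex
`a`: it fails exactly when some direction, the indicator of a set `D` of coordinates, leaves it
while staying inside the others to first order (`isRedundant_iff`).

If a direction at `a` leaves a half-space with another apex `b`, restricting it to the maximisers of
`a - b` gives a direction at `b` that leaves it too and is vacuously feasible for every half-space
with apex `a` (`exists_direction_of_not_isFeasible`). Hence the directions at `α` feasible for all
half-spaces with other apices can be computed from any generating family
(`IsGenerating.isFeasible`). Those that also leave some half-space at `α` containing the cone are
the critical ones; they depend only on the cone.

Critical directions missing a common covering set of sectors are closed under union, so a half-space
at `α` is left by at most one maximal critical direction. The classes are the half-spaces left by a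
given maximal one, and members of a class are interchangeable (`IsGenerating.exchange`). Finiteness
comes from compactness of the cone in projective space (`exists_finite_detecting`). -/

variable {n p : ℕ}

/-! ### Membership and containment in terms of maximisers -/

/-- The index `i` maximises `x - a`. -/
def IsMaxAt (x a : Fin n → ℝ) (i : Fin n) : Prop := ∀ k, x k - a k ≤ x i - a i

/-- The real vector `a` belongs to the cone generated by `v`. -/
def IsMember (v : Fin p → Fin n → ℝ) (a : Fin n → ℝ) : Prop :=
  ∀ i, ∃ r, IsMaxAt (v r) a i

/-- The half-space with apex `a` and sectors `I` contains the cone generated by `v`. -/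
def Covers (v : Fin p → Fin n → ℝ) (a : Fin n → ℝ) (I : Finset (Fin n)) : Prop :=
  ∀ r, ∃ i ∈ I, IsMaxAt (v r) a i

/-- Moving from `a` in the direction of the indicator of `D` does not leave, locally, the
half-space with apex `b` and sectors `J`. -/
def IsFeasible (a : Fin n → ℝ) (D : Finset (Fin n)) (b : Fin n → ℝ) (J : Finset (Fin n)) : Prop :=
  ∀ j ∈ D, j ∉ J → IsMaxAt a b j → ∃ i ∈ D, i ∈ J ∧ IsMaxAt a b i

theorem exists_isMaxAt (x a : Fin n → ℝ) (i₀ : Fin n) : ∃ i, IsMaxAt x a i := by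
  obtain ⟨i, -, hi⟩ := Finset.exists_max_image Finset.univ (fun k => x k - a k) ⟨i₀, Finset.mem_univ _⟩
  exact ⟨i, fun k => hi k (Finset.mem_univ _)⟩

theorem Covers.mono {v : Fin p → Fin n → ℝ} {a : Fin n → ℝ} {I J : Finset (Fin n)}
    (h : Covers v a I) (hIJ : I ⊆ J) : Covers v a J := fun r =>
  let ⟨i, hi, hm⟩ := h r
  ⟨i, hIJ hi, hm⟩

theorem mem_halfSpace_iff {x : MaxPlusVec n} {a : Fin n → ℝ} {I : Finset (Fin n)} :
    x ∈ halfSpace a I ↔ ∀ j ∉ I, x j = ⊥ ∨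
      ∃ i ∈ I, x j + ((-a j : ℝ) : WithBot ℝ) ≤ x i + ((-a i : ℝ) : WithBot ℝ) := by
  simp only [halfSpace, Set.mem_ofPred_eq, Finset.sup_le_iff, Finset.mem_compl]
  refine forall₂_congr fun j _ => ?_
  rcases eq_or_ne (x j) ⊥ with h | h
  · simp [h]
  · have : ⊥ < x j + ((-a j : ℝ) : WithBot ℝ) := by
      rw [bot_lt_iff_ne_bot]
      simp [WithBot.add_eq_bot, h]
    rw [Finset.le_sup_iff this]
    simp [h]

theorem ofReal_mem_halfSpace_iff {x a : Fin n → ℝ} {I : Finset (Fin n)} :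
    ofReal x ∈ halfSpace a I ↔ ∀ j ∉ I, ∃ i ∈ I, x j - a j ≤ x i - a i := by
  rw [mem_halfSpace_iff]
  simp only [ofReal, WithBot.coe_ne_bot, false_or, ← WithBot.coe_add, WithBot.coe_le_coe,
    ← sub_eq_add_neg]

/-- A half-space is unchanged when its apex is translated by a constant. -/
theorem halfSpace_add_const (a : Fin n → ℝ) (t : ℝ) (I : Finset (Fin n)) :
    halfSpace (fun i => a i + t) I = halfSpace a I := by
  ext x
  simp only [mem_halfSpace_iff]
  refine forall₂_congr fun j _ => or_congr_right (exists_congr fun i => and_congr_right fun _ => ?_)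
  generalize x j = y
  generalize x i = z
  induction y using WithBot.recBotCoe with
  | bot => simp
  | coe y =>
    induction z using WithBot.recBotCoe with
    | bot => simp [← WithBot.coe_add]
    | coe z =>
      simp only [← WithBot.coe_add, WithBot.coe_le_coe]
      constructor <;> intro h <;> linarith

/-- Residuation: the largest `t` with `t + v r ≤ a` is the minimum of `a - v r`, and `t + v r`
touches `a` exactly at the maximisers of `v r - a`. These best multiples must jointly touch every
coordinate. -/
theorem isMember_iff {v : Fin p → Fin n → ℝ} {a : Fin n → ℝ} :
    ofReal a ∈ tropicalSpan (fun r => ofReal (v r)) ↔ IsMember v a := by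
  constructor
  · rintro ⟨c, hc⟩ i
    have hpos : (⊥ : WithBot ℝ) < a i := WithBot.bot_lt_coe _
    have hi : (a i : WithBot ℝ) ≤ Finset.univ.sup (fun r => c r + ofReal (v r) i) := (hc i).le
    obtain ⟨r, -, hr⟩ := (Finset.le_sup_iff hpos).1 hi
    refine ⟨r, fun k => ?_⟩
    have hk : c r + ofReal (v r) k ≤ (a k : WithBot ℝ) :=
      (Finset.le_sup (f := fun r => c r + ofReal (v r) k) (Finset.mem_univ r)).trans (hc k).ge
    simp only [ofReal] at hr hk
    generalize c r = d at hr hk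
    induction d using WithBot.recBotCoe with
    | bot => simp at hr
    | coe d =>
      rw [← WithBot.coe_add, WithBot.coe_le_coe] at hr hk
      linarith
  · intro h
    have hm : ∀ r, ∃ t : ℝ, (∀ k, t + v r k ≤ a k) ∧ ∀ i, IsMaxAt (v r) a i → t + v r i = a i := by
      intro r
      rcases isEmpty_or_nonempty (Fin n) with hn | ⟨⟨i₀⟩⟩
      · exact ⟨0, fun k => hn.elim k, fun k => hn.elim k⟩
      · obtain ⟨i, hi⟩ := exists_isMaxAt (v r) a i₀
        refine ⟨a i - v r i, fun k => by linarith [hi k], fun j hj => ?_⟩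
        linarith [hi j, hj i]
    choose t ht ht' using hm
    refine ⟨fun r => (t r : WithBot ℝ), fun i => le_antisymm ?_ (Finset.sup_le fun r _ => ?_)⟩
    · obtain ⟨r, hr⟩ := h i
      refine le_trans ?_ (Finset.le_sup (Finset.mem_univ r))
      simp only [ofReal, ← WithBot.coe_add, WithBot.coe_le_coe]
      exact (ht' r i hr).ge
    · simp only [ofReal, ← WithBot.coe_add, WithBot.coe_le_coe]
      exact ht r i

theorem generator_mem (v : Fin p → Fin n → ℝ) (r : Fin p) :
    ofReal (v r) ∈ tropicalSpan (fun r => ofReal (v r)) :=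
  isMember_iff.2 fun _ => ⟨r, fun _ => by simp⟩

theorem covers_iff {v : Fin p → Fin n → ℝ} {a : Fin n → ℝ} {I : Finset (Fin n)}
    (hI : I.Nonempty) :
    tropicalSpan (fun r => ofReal (v r)) ⊆ halfSpace a I ↔ Covers v a I := by
  constructor
  · intro h r
    have hr := ofReal_mem_halfSpace_iff.1 (h (generator_mem v r))
    obtain ⟨i₀, -⟩ := hI
    obtain ⟨j, hj⟩ := exists_isMaxAt (v r) a i₀
    by_cases hjI : j ∈ I
    · exact ⟨j, hjI, hj⟩
    · obtain ⟨i, hi, hji⟩ := hr j hjI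
      exact ⟨i, hi, fun k => (hj k).trans hji⟩
  · rintro h x ⟨c, hc⟩
    rw [mem_halfSpace_iff]
    intro j _
    by_cases hx : x j = ⊥
    · exact Or.inl hx
    right
    have hle : x j ≤ Finset.univ.sup (fun r => c r + ofReal (v r) j) := (hc j).le
    obtain ⟨r, -, hr⟩ := (Finset.le_sup_iff (bot_lt_iff_ne_bot.2 hx)).1 hle
    obtain ⟨i, hi, hm⟩ := h r
    refine ⟨i, hi, ?_⟩
    have h1 : c r + ofReal (v r) i ≤ x i :=
      (Finset.le_sup (f := fun r => c r + ofReal (v r) i) (Finset.mem_univ r)).trans (hc i).ge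
    refine (add_le_add_left hr _).trans (le_trans ?_ (add_le_add_left h1 _))
    rw [add_assoc, add_assoc]
    refine add_le_add_right ?_ _
    simp only [ofReal, ← WithBot.coe_add, WithBot.coe_le_coe]
    linarith [hm j]

/-! ### Directions at an apex -/

/-- A vector outside of a half-space yields a direction leaving it at the apex, which is feasible
for every half-space containing the vector. -/
theorem exists_direction {a : Fin n → ℝ} {I : Finset (Fin n)} {x : MaxPlusVec n}
    (hx : x ∉ halfSpace a I) :
    ∃ D : Finset (Fin n), D.Nonempty ∧ Disjoint I D ∧
      ∀ b J, x ∈ halfSpace b J → IsFeasible a D b J := by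
  classical
  rw [mem_halfSpace_iff] at hx
  push Not at hx
  obtain ⟨j, hj, hjb, hji⟩ := hx
  obtain ⟨m, -, hm⟩ := Finset.exists_max_image Finset.univ
    (fun k => x k + ((-a k : ℝ) : WithBot ℝ)) ⟨j, Finset.mem_univ _⟩
  have hmb : x m ≠ ⊥ := by
    intro h
    have := hm j (Finset.mem_univ _)
    simp [h, WithBot.add_eq_bot, hjb] at this
  obtain ⟨y, hy⟩ := WithBot.ne_bot_iff_exists.1 hmb
  have hle : ∀ k (z : ℝ), (z : WithBot ℝ) = x k → z - a k ≤ y - a m := by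
    intro k z hz
    have := hm k (Finset.mem_univ _)
    simpa only [← hz, ← hy, ← WithBot.coe_add, WithBot.coe_le_coe, ← sub_eq_add_neg] using this
  -- `D` is the set of maximisers of `x - a`. An index maximising both `x - a` and `a - b` maximises
  -- `x - b`, which forces the witness in `J` to maximise both as well.
  refine ⟨Finset.univ.filter (fun k => x k = ((y - a m + a k : ℝ) : WithBot ℝ)), ?_, ?_, ?_⟩
  · exact ⟨m, Finset.mem_filter.2 ⟨Finset.mem_univ _, by rw [sub_add_cancel, hy]⟩⟩
  · rw [Finset.disjoint_left]
    intro i hi hiD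
    rw [Finset.mem_filter] at hiD
    have h1 := (hji i hi).trans_le (hm j (Finset.mem_univ _))
    simp only [hiD.2, ← hy, ← WithBot.coe_add, WithBot.coe_lt_coe] at h1
    linarith
  · intro b J hxb k hk hkJ hmax
    rw [Finset.mem_filter] at hk
    rcases mem_halfSpace_iff.1 hxb k hkJ with h | ⟨i, hi, hik⟩
    · simp [hk.2] at h
    have hib : x i ≠ ⊥ := by
      intro h
      simp [h, hk.2, ← WithBot.coe_add] at hik
    obtain ⟨z, hz⟩ := WithBot.ne_bot_iff_exists.1 hib
    have hzi := hle i z hz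
    rw [hk.2, ← hz, ← WithBot.coe_add, ← WithBot.coe_add, WithBot.coe_le_coe] at hik
    have hki := hmax i
    refine ⟨i, ?_, hi, fun l => ?_⟩
    · rw [Finset.mem_filter, ← hz, WithBot.coe_inj]
      exact ⟨Finset.mem_univ _, by linarith⟩
    · linarith [hmax l]

/-- Conversely, a feasible direction leads to points of finitely many half-spaces. -/
theorem eventually_mem_halfSpace {a b : Fin n → ℝ} {D J : Finset (Fin n)}
    (ha : ofReal a ∈ halfSpace b J) (h : IsFeasible a D b J) :
    ∀ᶠ ε : ℝ in nhdsWithin 0 (Set.Ioi 0),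
      ofReal (fun i => a i + if i ∈ D then ε else 0) ∈ halfSpace b J := by
  simp only [ofReal_mem_halfSpace_iff] at ha ⊢
  simp only [Filter.eventually_all]
  intro j hj
  obtain ⟨m, hm⟩ := exists_isMaxAt a b j
  obtain ⟨i, hi, hmi⟩ : ∃ i ∈ J, IsMaxAt a b i := by
    by_cases hmJ : m ∈ J
    · exact ⟨m, hmJ, hm⟩
    · obtain ⟨i, hi, hle⟩ := ha m hmJ
      exact ⟨i, hi, fun k => (hm k).trans hle⟩
  by_cases hjm : IsMaxAt a b j
  · by_cases hjD : j ∈ D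
    · obtain ⟨k, hkD, hkJ, hk⟩ := h j hjD hj hjm
      filter_upwards with ε
      refine ⟨k, hkJ, ?_⟩
      simp only [hjD, hkD, if_true]
      linarith [hk j]
    · filter_upwards [self_mem_nhdsWithin] with ε hε
      refine ⟨i, hi, ?_⟩
      have : (0 : ℝ) < ε := hε
      simp only [hjD, if_false]
      split_ifs <;> linarith [hmi j]
  -- A coordinate that does not maximise `a - b` has slack, so a small `ε` is harmless there.
  · have hlt : a j - b j < a i - b i := by
      by_contra! hle
      exact hjm fun k => (hmi k).trans hle
    filter_upwards [Ioo_mem_nhdsGT (sub_pos.2 hlt)] with ε hε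
    refine ⟨i, hi, ?_⟩
    obtain ⟨h1, h2⟩ := hε
    split_ifs <;> linarith

theorem shift_notMem_halfSpace {a : Fin n → ℝ} {I D : Finset (Fin n)} (hD : D.Nonempty)
    (hI : Disjoint I D) {ε : ℝ} (hε : 0 < ε) :
    ofReal (fun i => a i + if i ∈ D then ε else 0) ∉ halfSpace a I := by
  rw [ofReal_mem_halfSpace_iff]
  obtain ⟨j, hj⟩ := hD
  intro h
  obtain ⟨i, hi, hle⟩ := h j (Finset.disjoint_right.1 hI hj)
  simp only [hj, Finset.disjoint_left.1 hI hi, if_true, if_false] at hle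
  linarith

theorem IsFeasible.union {a b : Fin n → ℝ} {D D' J : Finset (Fin n)}
    (h : IsFeasible a D b J) (h' : IsFeasible a D' b J) : IsFeasible a (D ∪ D') b J := by
  intro j hj hjJ hm
  rcases Finset.mem_union.1 hj with hj | hj
  · obtain ⟨i, hi, hiJ⟩ := h j hj hjJ hm
    exact ⟨i, Finset.mem_union_left _ hi, hiJ⟩
  · obtain ⟨i, hi, hiJ⟩ := h' j hj hjJ hm
    exact ⟨i, Finset.mem_union_right _ hi, hiJ⟩

theorem isFeasible_self_iff {a : Fin n → ℝ} {D J : Finset (Fin n)} (hD : D.Nonempty) :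
    IsFeasible a D a J ↔ ¬ Disjoint J D := by
  have hmax : ∀ i, IsMaxAt a a i := fun i k => by simp
  rw [Finset.not_disjoint_iff]
  constructor
  · intro h
    obtain ⟨j, hj⟩ := hD
    by_cases hjJ : j ∈ J
    · exact ⟨j, hjJ, hj⟩
    · obtain ⟨i, hi, hiJ, -⟩ := h j hj hjJ (hmax j)
      exact ⟨i, hiJ, hi⟩
  · rintro ⟨i, hiJ, hi⟩ j _ _ _
    exact ⟨i, hi, hiJ, hmax i⟩

/-- If a direction at `a` is not feasible for the half-space with apex `b`, then there is a
direction at `b` leaving this half-space which is at least as feasible for other half-spaces. -/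
theorem exists_direction_of_not_isFeasible {a b : Fin n → ℝ} {D J : Finset (Fin n)}
    (h : ¬ IsFeasible a D b J) :
    ∃ D' : Finset (Fin n), D'.Nonempty ∧ Disjoint J D' ∧
      (∀ c K, IsFeasible a D c K → IsFeasible b D' c K) ∧
      ∀ K, (∃ i j, a i - b i ≠ a j - b j) → IsFeasible b D' a K := by
  classical
  unfold IsFeasible at h
  push Not at h
  obtain ⟨j, hjD, hjJ, hjm, hji⟩ := h
  -- On the maximisers of `a - b`, those of `b - c` are also maximisers of `a - c`, so feasibility
  -- at `a` transfers to `b`.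
  refine ⟨D.filter (IsMaxAt a b), ⟨j, by simp [hjD, hjm]⟩, ?_, ?_, ?_⟩
  · rw [Finset.disjoint_right]
    intro i hi hiJ
    rw [Finset.mem_filter] at hi
    exact hji i hi.1 hiJ hi.2
  · intro c K hc k hk hkK hkm
    rw [Finset.mem_filter] at hk
    obtain ⟨i, hi, hiK, him⟩ := hc k hk.1 hkK fun l => by linarith [hkm l, hk.2 l]
    have h1 := him k
    have h2 := hk.2 i
    have h3 := hkm i
    refine ⟨i, Finset.mem_filter.2 ⟨hi, fun l => ?_⟩, hiK, fun l => ?_⟩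
    · linarith [hk.2 l]
    · linarith [hkm l]
  -- An index maximising both `a - b` and `b - a` would make `a - b` constant, so the condition is
  -- vacuous.
  · rintro K ⟨i, l, hil⟩ k hk - hkm
    rw [Finset.mem_filter] at hk
    exact absurd (by linarith [hk.2 i, hk.2 l, hkm i, hkm l]) hil

/-! ### Separation by projection onto the cone -/

/-- Separation: the half-spaces with apex in the cone which contain the cone cut it out. -/
theorem exists_separating {v : Fin p → Fin n → ℝ} (hp : 0 < p) {x : MaxPlusVec n}
    (hx : x ∉ tropicalSpan (fun r => ofReal (v r))) :
    ∃ a I, IsMember v a ∧ Covers v a I ∧ x ∉ halfSpace a I := by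
  classical
  obtain ⟨M, hM⟩ := Finite.exists_le (fun q : Fin p × Fin n × Fin n =>
    v q.1 q.2.1 - v q.1 q.2.2 - (x q.2.1).unbotD 0)
  -- The value replacing `-∞` is so low that, if `x` has an infinite coordinate, the projection of
  -- `y` can touch `y` only at infinite coordinates of `x`.
  set y : Fin n → ℝ := fun i => (x i).unbotD (-(M + 1)) with hy
  obtain ⟨j₀, hj₀⟩ : ∃ j, x j ≠ ⊥ := by
    by_contra! h
    exact hx ⟨fun _ => ⊥, fun i => by simp [h i]⟩
  choose m hm using fun r => exists_isMaxAt (v r) y j₀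
  have hρ : ∀ i, ∃ r, ∀ s, y (m s) - v s (m s) + v s i ≤ y (m r) - v r (m r) + v r i := by
    intro i
    obtain ⟨r, -, hr⟩ := Finset.exists_max_image Finset.univ
      (fun s => y (m s) - v s (m s) + v s i) ⟨⟨0, hp⟩, Finset.mem_univ _⟩
    exact ⟨r, fun s => hr s (Finset.mem_univ _)⟩
  choose ρ hρ using hρ
  -- The greatest element of the cone below `y`; the sectors are the coordinates where it touches
  -- `y`.
  set a : Fin n → ℝ := fun i => y (m (ρ i)) - v (ρ i) (m (ρ i)) + v (ρ i) i with ha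
  have hay : ∀ i, a i ≤ y i := fun i => by
    have := hm (ρ i) i
    simp only [ha]
    linarith
  have hge : ∀ r i, y (m r) - v r (m r) + v r i ≤ a i := fun r i => hρ i r
  refine ⟨a, Finset.univ.filter (fun i => a i = y i), fun i => ⟨ρ i, fun k => ?_⟩,
    fun r => ⟨m r, ?_, fun k => ?_⟩, ?_⟩
  · have : a i = y (m (ρ i)) - v (ρ i) (m (ρ i)) + v (ρ i) i := rfl
    linarith [hge (ρ i) k]
  · rw [Finset.mem_filter]
    exact ⟨Finset.mem_univ _, le_antisymm (hay _) (by linarith [hge r (m r)])⟩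
  · linarith [hge r k, hay (m r)]
  · rw [mem_halfSpace_iff]
    push Not
    by_cases hfin : ∀ i, x i ≠ ⊥
    · have hxy : x = ofReal y := by
        funext i
        obtain ⟨z, hz⟩ := WithBot.ne_bot_iff_exists.1 (hfin i)
        simp [ofReal, hy, ← hz]
      obtain ⟨j, hj⟩ : ∃ j, a j ≠ y j := by
        by_contra! h
        refine hx ?_
        rw [hxy, isMember_iff]
        intro i
        refine ⟨ρ i, fun k => ?_⟩
        have : a i = y (m (ρ i)) - v (ρ i) (m (ρ i)) + v (ρ i) i := rfl
        linarith [hge (ρ i) k, h i, h k]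
      refine ⟨j, by simp [hj], hfin j, fun i hi => ?_⟩
      rw [Finset.mem_filter] at hi
      simp only [hxy, ofReal, ← WithBot.coe_add, WithBot.coe_lt_coe]
      linarith [hi.2, lt_of_le_of_ne (hay j) hj]
    · push Not at hfin
      obtain ⟨l, hl⟩ := hfin
      have hbot : ∀ i, a i = y i → x i = ⊥ := by
        intro i hi
        by_contra hne
        have h1 : a i = y (m (ρ i)) - v (ρ i) (m (ρ i)) + v (ρ i) i := rfl
        have h2 := hm (ρ i) l
        have h3 := hM (ρ i, i, l)
        obtain ⟨z, hz⟩ := WithBot.ne_bot_iff_exists.1 hne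
        have h4 : y i = z := by simp [hy, ← hz]
        have h5 : y l = -(M + 1) := by simp [hy, hl]
        simp only [← hz, WithBot.unbotD_coe] at h3
        linarith
      refine ⟨j₀, fun h => hj₀ (hbot j₀ (Finset.mem_filter.1 h).2), hj₀, fun i hi => ?_⟩
      rw [hbot i (Finset.mem_filter.1 hi).2, WithBot.bot_add, bot_lt_iff_ne_bot]
      simp [WithBot.add_eq_bot, hj₀]

/-! ### Finite detection by compactness -/

/-- Locally around `b`, finitely many half-spaces detect all directions leaving the cone. -/
theorem exists_local_scale (v : Fin p → Fin n → ℝ) (b : Fin n → ℝ) :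
    ∃ s : ℝ, 0 < s ∧ ∀ (a : Fin n → ℝ) (I D : Finset (Fin n)),
      (∀ i j, (a i - b i) - (a j - b j) < s) → IsMember v a → Covers v a I → D.Nonempty →
      Disjoint I D → ∃ K : Finset (Fin n), IsMember v (fun i => b i + if i ∈ K then s else 0) ∧
        Covers v (fun i => b i + if i ∈ K then s else 0) I ∧
        ¬ IsFeasible a D (fun i => b i + if i ∈ K then s else 0) I := by
  classical
  -- `s` is at most every positive gap between coordinates of `v r - b`.
  obtain ⟨s, hs, hs0⟩ : ∃ s : ℝ, (∀ q : Fin p × Fin n × Fin n,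
      0 < v q.1 q.2.1 - b q.2.1 - (v q.1 q.2.2 - b q.2.2) →
        s ≤ v q.1 q.2.1 - b q.2.1 - (v q.1 q.2.2 - b q.2.2)) ∧ 0 < s := by
    have hev : ∀ᶠ s : ℝ in nhdsWithin 0 (Set.Ioi 0), (∀ q : Fin p × Fin n × Fin n,
      0 < v q.1 q.2.1 - b q.2.1 - (v q.1 q.2.2 - b q.2.2) →
        s ≤ v q.1 q.2.1 - b q.2.1 - (v q.1 q.2.2 - b q.2.2)) := by
      simp only [Filter.eventually_all]
      intro q hq
      filter_upwards [Ioo_mem_nhdsGT hq] with s hs using hs.2.le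
    exact (hev.and self_mem_nhdsWithin).exists
  refine ⟨s, hs0, fun a I D hab hmem hcov ⟨j₀, hj₀⟩ hID => ?_⟩
  -- Thresholding `a - b` at `j₀ ∈ D` replaces `a` by one of finitely many points. Every maximiser
  -- of `v r - a` survives since `a - b` varies by less than `s`, and `j₀` maximises the difference
  -- from `a` to the new point, so `D` leaves the half-space there.
  set K := Finset.univ.filter (fun i => a j₀ - b j₀ < a i - b i) with hK
  have hKi : ∀ i, i ∈ K ↔ a j₀ - b j₀ < a i - b i := fun i => by simp [hK]
  have htype : ∀ r i, IsMaxAt (v r) a i →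
      IsMaxAt (v r) (fun i => b i + if i ∈ K then s else 0) i := by
    intro r i hi k
    have h1 := hi k
    have h2 := hab k i
    have h3 := hs (r, k, i)
    have h4 := hs (r, i, k)
    dsimp only at h3 h4 ⊢
    rcases lt_trichotomy (v r k - b k - (v r i - b i)) 0 with h | h | h
    · have := h4 (by linarith)
      split_ifs <;> linarith
    · have : i ∈ K → k ∈ K := by
        rw [hKi, hKi]
        intro h'
        linarith
      by_cases hiK : i ∈ K
      · simp only [hiK, this hiK, if_true]
        linarith
      · simp only [hiK, if_false]
        split_ifs <;> linarith
    · linarith [h3 h]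
  refine ⟨K, fun i => ?_, fun r => ?_, fun hfeas => ?_⟩
  · obtain ⟨r, hr⟩ := hmem i
    exact ⟨r, htype r i hr⟩
  · obtain ⟨i, hi, hir⟩ := hcov r
    exact ⟨i, hi, htype r i hir⟩
  · obtain ⟨i, hiD, hiI, -⟩ := hfeas j₀ hj₀ (Finset.disjoint_right.1 hID hj₀) fun k => by
      have h1 : j₀ ∉ K := by simp [hKi]
      have h2 := hab k j₀
      simp only [h1, if_false]
      split_ifs with h
      · linarith
      · rw [hKi] at h
        linarith
    exact Finset.disjoint_left.1 hID hiI hiD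

/-- Finitely many half-spaces detect all directions leaving the cone. -/
theorem exists_finite_detecting (v : Fin p → Fin n → ℝ) :
    ∃ F : Set ((Fin n → ℝ) × Finset (Fin n)), F.Finite ∧
      (∀ q ∈ F, IsMember v q.1 ∧ Covers v q.1 q.2 ∧ q.2ᶜ.Nonempty) ∧
      ∀ (a : Fin n → ℝ) (I D : Finset (Fin n)), IsMember v a → Covers v a I → D.Nonempty →
        Disjoint I D → ∃ q ∈ F, ¬ IsFeasible a D q.1 q.2 := by
  classical
  rcases isEmpty_or_nonempty (Fin n) with hn | ⟨⟨i₀⟩⟩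
  · exact ⟨∅, Set.finite_empty, by simp, fun a I D _ _ hD => (hn.elim hD.choose)⟩
  obtain ⟨M, hM⟩ := Finite.exists_le (fun q : Fin p × Fin n × Fin n => v q.1 q.2.1 - v q.1 q.2.2)
  choose s hs hdet using exists_local_scale v
  obtain ⟨t, -, ht⟩ := (isCompact_closedBall (0 : Fin n → ℝ) |M|).elim_nhds_subcover
    (fun b => Metric.ball b (s b / 2)) fun b _ => Metric.ball_mem_nhds b (half_pos (hs b))
  refine ⟨(⋃ b ∈ t, Set.range (fun q : Finset (Fin n) × Finset (Fin n) =>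
      ((fun i => b i + if i ∈ q.1 then s b else 0 : Fin n → ℝ), q.2))) ∩
      {q | IsMember v q.1 ∧ Covers v q.1 q.2 ∧ q.2ᶜ.Nonempty},
    Set.Finite.inter_of_left (t.finite_toSet.biUnion fun b _ => Set.finite_range _) _,
    fun q hq => hq.2, fun a I D hmem hcov hD hID => ?_⟩
  -- Coordinate differences of a member are bounded by those of the generators.
  have hball : (fun i => a i - a i₀) ∈ Metric.closedBall (0 : Fin n → ℝ) |M| := by
    rw [mem_closedBall_zero_iff, pi_norm_le_iff_of_nonneg (abs_nonneg M)]
    intro i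
    obtain ⟨r, hr⟩ := hmem i
    obtain ⟨r', hr'⟩ := hmem i₀
    have h1 := hM (r, i, i₀)
    have h2 := hM (r', i₀, i)
    have h3 := hr i₀
    have h4 := hr' i
    refine le_trans (abs_le.2 ⟨?_, ?_⟩) (le_abs_self M) <;> dsimp only at h1 h2 ⊢ <;> linarith
  have hcover := ht hball
  simp only [Set.mem_iUnion, Metric.mem_ball] at hcover
  obtain ⟨b, hbt, hb⟩ := hcover
  obtain ⟨K, hK1, hK2, hK3⟩ := hdet b a I D (fun i j => by
    have h1 := (dist_le_pi_dist (fun i => a i - a i₀) b i).trans_lt hb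
    have h2 := (dist_le_pi_dist (fun i => a i - a i₀) b j).trans_lt hb
    rw [Real.dist_eq, abs_lt] at h1 h2
    linarith [h1.2, h2.1]) hmem hcov hD hID
  refine ⟨(fun i => b i + if i ∈ K then s b else 0, I), ⟨?_, hK1, hK2, ?_⟩, hK3⟩
  · exact Set.mem_biUnion hbt ⟨(K, I), rfl⟩
  · obtain ⟨j, hj⟩ := hD
    exact ⟨j, Finset.mem_compl.2 (Finset.disjoint_right.1 hID hj)⟩

/-! ### Projective apices; a half-space determines its apex and sectors -/

theorem toProj_eq_iff {a b : Fin n → ℝ} : toProj a = toProj b ↔ ∃ t, a = fun i => b i + t := by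
  rw [toProj, toProj, Submodule.Quotient.eq, Submodule.mem_span_singleton]
  refine exists_congr fun t => ⟨fun h => funext fun i => ?_, fun h => funext fun i => ?_⟩
  · have := congrFun h i
    simp only [Pi.smul_apply, smul_eq_mul, mul_one, Pi.sub_apply] at this
    linarith
  · have := congrFun h i
    simp only [Pi.smul_apply, smul_eq_mul, mul_one, Pi.sub_apply]
    linarith

/-- A real representative of a point of the projective space. -/
noncomputable def rep (α : ProjSpace n) : Fin n → ℝ :=
  (Submodule.Quotient.mk_surjective _ α).choose

theorem toProj_rep (α : ProjSpace n) : toProj (rep α) = α :=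
  (Submodule.Quotient.mk_surjective _ α).choose_spec

theorem exists_rep_toProj (a : Fin n → ℝ) : ∃ t, a = fun i => rep (toProj a) i + t :=
  toProj_eq_iff.1 (toProj_rep _).symm

theorem IsMaxAt.add_const {x a : Fin n → ℝ} {i : Fin n} (h : IsMaxAt x a i) (t : ℝ) :
    IsMaxAt x (fun i => a i + t) i := fun k => by linarith [h k]

theorem isMaxAt_add_const_iff {x a : Fin n → ℝ} {i : Fin n} {t : ℝ} :
    IsMaxAt x (fun i => a i + t) i ↔ IsMaxAt x a i :=
  ⟨fun h => by simpa using h.add_const (-t), fun h => h.add_const t⟩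

theorem isFeasible_rep_iff {a b : Fin n → ℝ} {D J : Finset (Fin n)} :
    IsFeasible a D (rep (toProj b)) J ↔ IsFeasible a D b J := by
  obtain ⟨t, ht⟩ := exists_rep_toProj b
  conv_rhs => rw [ht]
  simp only [IsFeasible, isMaxAt_add_const_iff]

/-- The half-space given by an apex in the projective space and a set of sectors. -/
def halfSpaceOf (q : ProjSpace n × Finset (Fin n)) : Set (MaxPlusVec n) :=
  halfSpace (rep q.1) q.2

theorem halfSpace_eq_halfSpaceOf (a : Fin n → ℝ) (I : Finset (Fin n)) :
    halfSpace a I = halfSpaceOf (toProj a, I) := by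
  obtain ⟨t, ht⟩ := exists_rep_toProj a
  rw [ht, halfSpace_add_const, ← ht, halfSpaceOf]

theorem isMember_rep_iff {v : Fin p → Fin n → ℝ} {a : Fin n → ℝ} :
    IsMember v (rep (toProj a)) ↔ IsMember v a := by
  obtain ⟨t, ht⟩ := exists_rep_toProj a
  conv_rhs => rw [ht]
  simp only [IsMember, isMaxAt_add_const_iff]

theorem covers_rep_iff {v : Fin p → Fin n → ℝ} {a : Fin n → ℝ} {I : Finset (Fin n)} :
    Covers v (rep (toProj a)) I ↔ Covers v a I := by
  obtain ⟨t, ht⟩ := exists_rep_toProj a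
  conv_rhs => rw [ht]
  simp only [Covers, isMaxAt_add_const_iff]

theorem mem_projImage_iff {v : Fin p → Fin n → ℝ} {α : ProjSpace n} :
    α ∈ projImage (tropicalSpan (fun r => ofReal (v r))) ↔ IsMember v (rep α) := by
  constructor
  · rintro ⟨x, hx, rfl⟩
    exact isMember_rep_iff.2 (isMember_iff.1 hx)
  · intro h
    exact ⟨rep α, isMember_iff.2 h, toProj_rep α⟩

/-- Tropical unit vectors recover the sectors; vectors with two finite entries, below, recover the
apex. -/
theorem mem_sectors_iff {a : Fin n → ℝ} {I : Finset (Fin n)} {j : Fin n} :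
    (fun k => if k = j then ((0 : ℝ) : WithBot ℝ) else ⊥) ∈ halfSpace a I ↔ j ∈ I := by
  rw [mem_halfSpace_iff]
  constructor
  · intro h
    by_contra hj
    rcases h j hj with h | ⟨i, hi, hle⟩
    · simp at h
    · have : i ≠ j := fun h => hj (h ▸ hi)
      simp [this] at hle
  · intro hj k hk
    left
    have : k ≠ j := fun h => hk (h ▸ hj)
    simp [this]

theorem pair_mem_halfSpace_iff {a : Fin n → ℝ} {I : Finset (Fin n)} {i j : Fin n} (hi : i ∈ I)
    (hj : j ∉ I) (t : ℝ) :
    (fun k => if k = i then (t : WithBot ℝ) else if k = j then ((0 : ℝ) : WithBot ℝ) else ⊥) ∈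
      halfSpace a I ↔ a i - a j ≤ t := by
  have hij : j ≠ i := fun h => hj (h ▸ hi)
  rw [mem_halfSpace_iff]
  constructor
  · intro h
    rcases h j hj with h | ⟨k, hk, hle⟩
    · simp [hij] at h
    · have hkj : k ≠ j := fun h => hj (h ▸ hk)
      by_cases hki : k = i
      · simp only [hij, hki, if_true, if_false, ← WithBot.coe_add, WithBot.coe_le_coe] at hle
        linarith
      · simp [hij, hki, hkj] at hle
  · intro h k hk
    by_cases hkj : k = j
    · refine Or.inr ⟨i, hi, ?_⟩
      simp only [hkj, hij, if_true, if_false, ← WithBot.coe_add, WithBot.coe_le_coe]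
      linarith
    · left
      have : k ≠ i := fun h => hk (h ▸ hi)
      simp [this, hkj]

/-- A non-degenerate half-space determines its apex and its sectors. -/
theorem halfSpaceOf_injOn :
    Set.InjOn (halfSpaceOf (n := n)) {q | q.2.Nonempty ∧ q.2ᶜ.Nonempty} := by
  rintro ⟨α, I⟩ ⟨hI, hIc⟩ ⟨β, J⟩ - h
  simp only [halfSpaceOf] at h hI hIc
  obtain rfl : I = J := by
    ext j
    rw [← mem_sectors_iff (a := rep α), h, mem_sectors_iff]
  have hdiff : ∀ i ∈ I, ∀ j ∉ I, rep α i - rep α j = rep β i - rep β j := by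
    intro i hi j hj
    apply le_antisymm
    · rw [← pair_mem_halfSpace_iff hi hj, h, pair_mem_halfSpace_iff hi hj]
    · rw [← pair_mem_halfSpace_iff hi hj, ← h, pair_mem_halfSpace_iff hi hj]
  obtain ⟨i, hi⟩ := hI
  obtain ⟨j, hj⟩ := hIc
  rw [Finset.mem_compl] at hj
  have : α = β := by
    rw [← toProj_rep α, ← toProj_rep β, toProj_eq_iff]
    refine ⟨rep α i - rep β i, funext fun k => ?_⟩
    by_cases hk : k ∈ I
    · linarith [hdiff i hi j hj, hdiff k hk j hj]
    · linarith [hdiff i hi k hk]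
  rw [this]

theorem isHalfSpaceWithApex_iff {H : Set (MaxPlusVec n)} {α : ProjSpace n} :
    IsHalfSpaceWithApex H α ↔ ∃ I : Finset (Fin n), I.Nonempty ∧ Iᶜ.Nonempty ∧
      H = halfSpaceOf (α, I) := by
  constructor
  · rintro ⟨x, I, rfl, hI, hIc, rfl⟩
    exact ⟨I, hI, hIc, halfSpace_eq_halfSpaceOf x I⟩
  · rintro ⟨I, hI, hIc, rfl⟩
    exact ⟨rep α, I, toProj_rep α, hI, hIc, rfl⟩

/-! ### Redundancy as exposure by directions -/

/-- The half-spaces with apex in the cone generated by `v` which contain this cone. -/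
def facets (v : Fin p → Fin n → ℝ) : Set (ProjSpace n × Finset (Fin n)) :=
  {q | IsMember v (rep q.1) ∧ Covers v (rep q.1) q.2 ∧ q.2ᶜ.Nonempty}

/-- Some direction at the apex of `q` leaves the half-space `q` and is feasible for `G`. -/
def IsExposed (q : ProjSpace n × Finset (Fin n)) (G : Set (ProjSpace n × Finset (Fin n))) : Prop :=
  ∃ D : Finset (Fin n), D.Nonempty ∧ Disjoint q.2 D ∧
    ∀ g ∈ G, IsFeasible (rep q.1) D (rep g.1) g.2

/-- The family `G` implies all half-spaces with apex in the cone which contain this cone. -/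
def IsGenerating (v : Fin p → Fin n → ℝ) (G : Set (ProjSpace n × Finset (Fin n))) : Prop :=
  ∀ q ∈ facets v, ¬ IsExposed q G

/-- The direction `D` at `α` leaves the cone but none of the half-spaces containing the cone and
having another apex in the cone. -/
def IsCritical (v : Fin p → Fin n → ℝ) (α : ProjSpace n) (D : Finset (Fin n)) : Prop :=
  IsMember v (rep α) ∧ D.Nonempty ∧ Covers v (rep α) Dᶜ ∧
    ∀ q ∈ facets v, q.1 ≠ α → IsFeasible (rep α) D (rep q.1) q.2

theorem IsExposed.mono {q : ProjSpace n × Finset (Fin n)}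
    {G G' : Set (ProjSpace n × Finset (Fin n))} (h : IsExposed q G') (hG : G ⊆ G') :
    IsExposed q G :=
  let ⟨D, hD, hqD, hf⟩ := h
  ⟨D, hD, hqD, fun g hg => hf g (hG hg)⟩

/-- The direction exposing `q` must leave `g`, so it can be carried to the apex of `g`. This is what
allows members to be dropped or swapped. -/
theorem IsExposed.of_not_insert {q g : ProjSpace n × Finset (Fin n)}
    {G : Set (ProjSpace n × Finset (Fin n))} (h : IsExposed q G) (hn : ¬ IsExposed q (insert g G)) :
    IsExposed g G := by
  obtain ⟨D, hD, hqD, hf⟩ := h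
  have hg : ¬ IsFeasible (rep q.1) D (rep g.1) g.2 := fun hg =>
    hn ⟨D, hD, hqD, fun k hk => hk.elim (fun h => h ▸ hg) (hf k)⟩
  obtain ⟨D', hD', hgD', h', -⟩ := exists_direction_of_not_isFeasible hg
  exact ⟨D', hD', hgD', fun k hk => h' _ _ (hf k hk)⟩

theorem nonempty_of_covers {v : Fin p → Fin n → ℝ} {a : Fin n → ℝ} {I : Finset (Fin n)}
    (hp : 0 < p) (h : Covers v a I) : I.Nonempty :=
  let ⟨i, hi, _⟩ := h ⟨0, hp⟩
  ⟨i, hi⟩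

theorem subset_halfSpaceOf {v : Fin p → Fin n → ℝ} (hp : 0 < p)
    {q : ProjSpace n × Finset (Fin n)} (hq : q ∈ facets v) :
    tropicalSpan (fun r => ofReal (v r)) ⊆ halfSpaceOf q :=
  (covers_iff (nonempty_of_covers hp hq.2.1)).2 hq.2.1

theorem halfSpaceOf_injOn_facets {v : Fin p → Fin n → ℝ} (hp : 0 < p) :
    Set.InjOn halfSpaceOf (facets v) :=
  halfSpaceOf_injOn.mono fun q (hq : q ∈ facets v) =>
    show q ∈ {q | q.2.Nonempty ∧ q.2ᶜ.Nonempty} from ⟨nonempty_of_covers hp hq.2.1, hq.2.2⟩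

/-- A separating vector yields a direction at the apex; conversely, finiteness of `G` allows one
small step that stays in all its members. -/
theorem isRedundant_iff {v : Fin p → Fin n → ℝ} (hp : 0 < p)
    {G : Set (ProjSpace n × Finset (Fin n))} (hG : G.Finite) (hGv : G ⊆ facets v)
    {q : ProjSpace n × Finset (Fin n)} (hq : q ∈ facets v) :
    IsRedundant (halfSpaceOf q) (halfSpaceOf '' G) ↔ ¬ IsExposed q G := by
  rw [IsRedundant, Set.sInter_image, ← not_iff_not, not_not, Set.not_subset]
  constructor
  · rintro ⟨x, hx, hxq⟩
    obtain ⟨D, hD, hqD, hf⟩ := exists_direction hxq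
    exact ⟨D, hD, hqD, fun g hg => hf _ _ (Set.mem_iInter₂.1 hx g hg)⟩
  · rintro ⟨D, hD, hqD, hf⟩
    have hev := (Filter.eventually_all_finite hG).2 fun g hg => eventually_mem_halfSpace
      (subset_halfSpaceOf hp (hGv hg) (isMember_iff.2 hq.1)) (hf g hg)
    obtain ⟨ε, hε, hε0⟩ := (hev.and self_mem_nhdsWithin).exists
    exact ⟨_, Set.mem_iInter₂.2 hε, shift_notMem_halfSpace hD hqD hε0⟩

theorem eq_sInter_iff {v : Fin p → Fin n → ℝ} (hp : 0 < p)
    {G : Set (ProjSpace n × Finset (Fin n))} (hG : G.Finite) (hGv : G ⊆ facets v) :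
    tropicalSpan (fun r => ofReal (v r)) = ⋂₀ (halfSpaceOf '' G) ↔ IsGenerating v G := by
  constructor
  · intro h q hq
    rw [← isRedundant_iff hp hG hGv hq, IsRedundant, ← h]
    exact subset_halfSpaceOf hp hq
  · intro h
    apply Set.Subset.antisymm
    · rintro x hx _ ⟨g, hg, rfl⟩
      exact subset_halfSpaceOf hp (hGv hg) hx
    · intro x hx
      by_contra hxC
      obtain ⟨a, I, ha, hI, hxI⟩ := exists_separating hp hxC
      rw [halfSpace_eq_halfSpaceOf] at hxI
      have hIc : Iᶜ.Nonempty := by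
        obtain ⟨D, ⟨j, hj⟩, hID, -⟩ := exists_direction hxI
        exact ⟨j, Finset.mem_compl.2 (Finset.disjoint_right.1 hID hj)⟩
      have hq : (toProj a, I) ∈ facets v := ⟨isMember_rep_iff.2 ha, covers_rep_iff.2 hI, hIc⟩
      exact hxI ((isRedundant_iff hp hG hGv hq).2 (h _ hq) hx)

theorem isNonRedundantRepresentation_iff {v : Fin p → Fin n → ℝ} (hp : 0 < p)
    {G : Set (ProjSpace n × Finset (Fin n))} (hG : G.Finite) (hGv : G ⊆ facets v) :
    IsNonRedundantRepresentation (tropicalSpan (fun r => ofReal (v r))) (halfSpaceOf '' G) ↔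
      IsGenerating v G ∧ ∀ g ∈ G, IsExposed g (G \ {g}) := by
  rw [IsNonRedundantRepresentation, eq_sInter_iff hp hG hGv, Set.forall_mem_image]
  refine and_congr_right fun _ => forall₂_congr fun g hg => ?_
  have : halfSpaceOf '' G \ {halfSpaceOf g} = halfSpaceOf '' (G \ {g}) := by
    rw [((halfSpaceOf_injOn_facets hp).mono hGv).image_sdiff_subset (by simpa using hg),
      Set.image_singleton]
  rw [this, isRedundant_iff hp (hG.subset Set.sdiff_subset) (Set.sdiff_subset.trans hGv) (hGv hg),
    not_not]

theorem exists_sub_ne {α β : ProjSpace n} (h : β ≠ α) :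
    ∃ i j, rep α i - rep β i ≠ rep α j - rep β j := by
  by_contra! hc
  apply h
  rw [← toProj_rep α, ← toProj_rep β, toProj_eq_iff]
  rcases isEmpty_or_nonempty (Fin n) with hn | ⟨⟨i₀⟩⟩
  · exact ⟨0, funext fun i => hn.elim i⟩
  · exact ⟨rep β i₀ - rep α i₀, funext fun i => by linarith [hc i i₀]⟩

/-! ### Critical directions -/

/-- Directions at `α` which are feasible for the members of a generating family with another apex
are feasible for all half-spaces with another apex. -/
theorem IsGenerating.isFeasible {v : Fin p → Fin n → ℝ}
    {G : Set (ProjSpace n × Finset (Fin n))} (hG : IsGenerating v G) {α : ProjSpace n}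
    {D : Finset (Fin n)} (hD : ∀ g ∈ G, g.1 ≠ α → IsFeasible (rep α) D (rep g.1) g.2) :
    ∀ q ∈ facets v, q.1 ≠ α → IsFeasible (rep α) D (rep q.1) q.2 := by
  intro q hq hqα
  by_contra hf
  obtain ⟨D', hD', hqD, h1, h2⟩ := exists_direction_of_not_isFeasible hf
  refine hG q hq ⟨D', hD', hqD, fun g hg => ?_⟩
  by_cases hgα : g.1 = α
  · rw [hgα]
    exact h2 _ (exists_sub_ne hqα)
  · exact h1 _ _ (hD g hg hgα)

theorem IsCritical.union {v : Fin p → Fin n → ℝ} {α : ProjSpace n} {D D' I : Finset (Fin n)}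
    (h : IsCritical v α D) (h' : IsCritical v α D') (hI : Covers v (rep α) I)
    (hD : Disjoint I D) (hD' : Disjoint I D') : IsCritical v α (D ∪ D') :=
  ⟨h.1, h.2.1.mono Finset.subset_union_left,
    hI.mono (Finset.subset_compl_iff_disjoint_right.2 (Finset.disjoint_union_right.2 ⟨hD, hD'⟩)),
    fun q hq hqα => (h.2.2.2 q hq hqα).union (h'.2.2.2 q hq hqα)⟩

/-- The union of the two directions still misses `I`, hence is critical, and maximality absorbs it.
Disjointness of the classes rests on this. -/
theorem IsCritical.subset_of_maximal {v : Fin p → Fin n → ℝ} {α : ProjSpace n}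
    {D D' I : Finset (Fin n)} (h : IsCritical v α D) (h' : Maximal (IsCritical v α) D')
    (hI : Covers v (rep α) I) (hD : Disjoint I D) (hD' : Disjoint I D') : D ⊆ D' :=
  Finset.subset_union_left.trans
    (h'.2 (h.union h'.1 hI hD hD') Finset.subset_union_right)

theorem IsCritical.exists_maximal {v : Fin p → Fin n → ℝ} {α : ProjSpace n}
    {D : Finset (Fin n)} (h : IsCritical v α D) : ∃ D', D ⊆ D' ∧ Maximal (IsCritical v α) D' :=
  (Set.toFinite {D | IsCritical v α D}).exists_le_maximal h

theorem IsCritical.mem_facets {v : Fin p → Fin n → ℝ} {α : ProjSpace n}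
    {D I : Finset (Fin n)} (h : IsCritical v α D) (hI : Covers v (rep α) I) (hD : Disjoint I D) :
    (α, I) ∈ facets v := by
  obtain ⟨j, hj⟩ := h.2.1
  exact ⟨h.1, hI, j, Finset.mem_compl.2 (Finset.disjoint_right.1 hD hj)⟩

/-- A critical direction leaves some member of a generating family having the same apex. -/
theorem IsGenerating.exists_disjoint {v : Fin p → Fin n → ℝ}
    {G : Set (ProjSpace n × Finset (Fin n))} (hG : IsGenerating v G) (hGv : G ⊆ facets v)
    {α : ProjSpace n} {D : Finset (Fin n)} (hD : IsCritical v α D) :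
    ∃ g ∈ G, g.1 = α ∧ Disjoint g.2 D := by
  by_contra! h
  have hdisj : Disjoint Dᶜ D := disjoint_compl_left
  refine hG _ (hD.mem_facets hD.2.2.1 hdisj) ⟨D, hD.2.1, hdisj, fun g hg => ?_⟩
  by_cases hgα : g.1 = α
  · rw [hgα]
    exact (isFeasible_self_iff hD.2.1).2 (h g hg hgα)
  · exact hD.2.2.2 g (hGv hg) hgα

/-- An exposed member of a generating family is exposed by a critical direction. -/
theorem IsGenerating.exists_isCritical {v : Fin p → Fin n → ℝ}
    {G : Set (ProjSpace n × Finset (Fin n))} (hG : IsGenerating v G)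
    {q : ProjSpace n × Finset (Fin n)} (hq : q ∈ facets v)
    (hqG : IsExposed q (G \ {q})) :
    ∃ D, IsCritical v q.1 D ∧ Disjoint q.2 D ∧
      ∀ g ∈ G, g ≠ q → g.1 = q.1 → ¬ Disjoint g.2 D := by
  obtain ⟨D, hD, hqD, hf⟩ := hqG
  refine ⟨D, ⟨hq.1, hD, hq.2.1.mono (Finset.subset_compl_iff_disjoint_right.2 hqD), ?_⟩, hqD, ?_⟩
  · exact hG.isFeasible fun g hg hgα => hf g ⟨hg, fun h => hgα (by rw [h])⟩
  · intro g hg hgq hgα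
    have := hf g ⟨hg, hgq⟩
    rwa [hgα, isFeasible_self_iff hD] at this

/-! ### Transversals and exchange -/

/-- The family `G` consists of one half-space for each maximal critical direction. -/
def IsTransversal (v : Fin p → Fin n → ℝ) (G : Set (ProjSpace n × Finset (Fin n))) : Prop :=
  (∀ g ∈ G, ∃ D, Maximal (IsCritical v g.1) D ∧ Disjoint g.2 D) ∧
    ∀ α D, Maximal (IsCritical v α) D → ∃! g, g ∈ G ∧ g.1 = α ∧ Disjoint g.2 D

/-- Some member of `G` is left by each maximal critical direction. Two would be a contradiction: the
direction exposing one lies inside the maximal one, so the other is left by it too. -/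
theorem IsGenerating.isTransversal {v : Fin p → Fin n → ℝ}
    {G : Set (ProjSpace n × Finset (Fin n))} (hG : IsGenerating v G) (hGv : G ⊆ facets v)
    (hexp : ∀ g ∈ G, IsExposed g (G \ {g})) : IsTransversal v G := by
  constructor
  · intro g hg
    obtain ⟨D, hD, hgD, hother⟩ := hG.exists_isCritical (hGv hg) (hexp g hg)
    obtain ⟨D', hDD', hD'⟩ := hD.exists_maximal
    obtain ⟨g', hg', hα, hdisj⟩ := hG.exists_disjoint hGv hD'.1
    obtain rfl : g' = g := by
      by_contra hne
      exact hother g' hg' hne hα (hdisj.mono_right hDD')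
    exact ⟨D', hD', hdisj⟩
  · intro α D hD
    obtain ⟨g, hg, rfl, hdisj⟩ := hG.exists_disjoint hGv hD.1
    refine ⟨g, ⟨hg, rfl, hdisj⟩, ?_⟩
    rintro g' ⟨hg', hα, hdisj'⟩
    by_contra hne
    obtain ⟨D₁, hD₁, hgD₁, hother⟩ := hG.exists_isCritical (hGv hg) (hexp g hg)
    exact hother g' hg' hne hα
      (hdisj'.mono_right (hD₁.subset_of_maximal hD (hGv hg).2.1 hgD₁ hdisj))

theorem IsTransversal.isExposed {v : Fin p → Fin n → ℝ}
    {G : Set (ProjSpace n × Finset (Fin n))} (hG : IsTransversal v G) (hGv : G ⊆ facets v) :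
    ∀ g ∈ G, IsExposed g (G \ {g}) := by
  rintro ⟨α, I⟩ hg
  obtain ⟨D, hD, hgD⟩ := hG.1 _ hg
  refine ⟨D, hD.1.2.1, hgD, ?_⟩
  rintro ⟨β, J⟩ ⟨hq, hqg⟩
  by_cases hβ : β = α
  · subst hβ
    refine (isFeasible_self_iff hD.1.2.1).2 fun hJD => hqg ?_
    exact (hG.2 _ D hD).unique ⟨hq, rfl, hJD⟩ ⟨hg, rfl, hgD⟩
  · exact hD.1.2.2.2 _ (hGv hq) hβ

/-- A member of a generating family may be replaced by another half-space with the same apex and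
the same maximal critical direction. -/
theorem IsGenerating.exchange {v : Fin p → Fin n → ℝ}
    {G : Set (ProjSpace n × Finset (Fin n))} (hG : IsGenerating v G) (hGv : G ⊆ facets v)
    {α : ProjSpace n} {I J D : Finset (Fin n)} (hI : (α, I) ∈ G)
    (hD : Maximal (IsCritical v α) D) (hID : Disjoint I D) (hJD : Disjoint J D) :
    IsGenerating v (insert (α, J) (G \ {(α, I)})) := by
  have hcov := (hGv hI).2.1
  have hnot : ¬ IsExposed (α, I) (insert (α, J) (G \ {(α, I)})) := by
    rintro ⟨D', hD', hID', hf⟩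
    -- The swap does not touch members with other apices, so `D'` is critical, hence inside `D`, and
    -- it leaves `(α, J)` as well.
    have hcrit : IsCritical v α D' :=
      ⟨hD.1.1, hD', hcov.mono (Finset.subset_compl_iff_disjoint_right.2 hID'),
        hG.isFeasible fun g hg hgα => hf g (Or.inr ⟨hg, fun h => hgα (by rw [h])⟩)⟩
    have hsub := hcrit.subset_of_maximal hD hcov hID' hID
    exact (isFeasible_self_iff hD').1 (hf (α, J) (Or.inl rfl)) (hJD.mono_right hsub)
  refine fun q hq hexp => hnot (hexp.of_not_insert fun h => hG q hq (h.mono fun g hg => ?_))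
  by_cases hgI : g = (α, I)
  · exact Or.inl hgI
  · exact Or.inr (Or.inr ⟨hg, hgI⟩)

theorem IsGenerating.mono {v : Fin p → Fin n → ℝ} {G G' : Set (ProjSpace n × Finset (Fin n))}
    (hG : IsGenerating v G) (h : G ⊆ G') : IsGenerating v G' := by
  exact fun q hq hexp => hG q hq (hexp.mono h)

/-- The known generating family `G₁` is turned into a subfamily of `G` by exchanges, each removing
one element of `G₁ \ G`. -/
theorem IsTransversal.isGenerating {v : Fin p → Fin n → ℝ}
    {G G₁ : Set (ProjSpace n × Finset (Fin n))} (hG : IsTransversal v G) (hGv : G ⊆ facets v)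
    (hfin : G₁.Finite) (hG₁v : G₁ ⊆ facets v) (hG₁ : IsGenerating v G₁)
    (hmax : ∀ g ∈ G₁, ∃ D, Maximal (IsCritical v g.1) D ∧ Disjoint g.2 D) :
    IsGenerating v G := by
  induction hk : (G₁ \ G).ncard using Nat.strong_induction_on generalizing G₁ with
  | _ k ih =>
    by_cases hsub : G₁ ⊆ G
    · exact hG₁.mono hsub
    obtain ⟨⟨α, I⟩, hI, hIG⟩ := Set.not_subset.1 hsub
    obtain ⟨D, hD, hID⟩ := hmax _ hI
    obtain ⟨⟨β, J⟩, ⟨hJ, hβ, hJD⟩, -⟩ := hG.2 α D hD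
    obtain rfl : β = α := hβ
    have hdiff : insert (β, J) (G₁ \ {(β, I)}) \ G = (G₁ \ G) \ {(β, I)} := by
      rw [Set.insert_sdiff_of_mem _ hJ, Set.sdiff_sdiff_comm]
    refine ih _ ?_ ((hfin.subset Set.sdiff_subset).insert _) ?_
      (hG₁.exchange hG₁v hI hD hID hJD) ?_ rfl
    · rw [hdiff, ← hk]
      exact Set.ncard_sdiff_singleton_lt_of_mem ⟨hI, hIG⟩ (hfin.subset Set.sdiff_subset)
    · exact Set.insert_subset (hGv hJ) (Set.sdiff_subset.trans hG₁v)
    · rintro g (rfl | hg)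
      · exact ⟨D, hD, hJD⟩
      · exact hmax g hg.1

theorem exists_finite_isGenerating (v : Fin p → Fin n → ℝ) :
    ∃ G : Set (ProjSpace n × Finset (Fin n)), G.Finite ∧ G ⊆ facets v ∧ IsGenerating v G := by
  obtain ⟨F, hF, hFv, hdet⟩ := exists_finite_detecting v
  refine ⟨(fun q => (toProj q.1, q.2)) '' F, hF.image _, ?_, ?_⟩
  · rintro _ ⟨q, hq, rfl⟩
    obtain ⟨h1, h2, h3⟩ := hFv q hq
    exact ⟨isMember_rep_iff.2 h1, covers_rep_iff.2 h2, h3⟩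
  · rintro q hq ⟨D, hD, hqD, hf⟩
    obtain ⟨g, hg, hgf⟩ := hdet (rep q.1) q.2 D hq.1 hq.2.1 hD hqD
    exact hgf (isFeasible_rep_iff.1 (hf _ (Set.mem_image_of_mem _ hg)))

/-- Non-redundant generating families exist. -/
theorem exists_minimal_isGenerating (v : Fin p → Fin n → ℝ) :
    ∃ G : Set (ProjSpace n × Finset (Fin n)), G.Finite ∧ G ⊆ facets v ∧ IsGenerating v G ∧
      ∀ g ∈ G, IsExposed g (G \ {g}) := by
  obtain ⟨G₀, hfin, hG₀v, hG₀⟩ := exists_finite_isGenerating v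
  obtain ⟨G, -, hG⟩ := (hfin.finite_subsets.subset
    (fun G (hG : G ⊆ G₀ ∧ IsGenerating v G) => hG.1)).exists_le_minimal
    (a := G₀) (s := {G | G ⊆ G₀ ∧ IsGenerating v G}) ⟨subset_rfl, hG₀⟩
  refine ⟨G, hfin.subset hG.1.1, hG.1.1.trans hG₀v, hG.1.2, fun g hg => ?_⟩
  by_contra hn
  have hgen : IsGenerating v (G \ {g}) := fun q hq hexp =>
    hn (hexp.of_not_insert (by
      rw [Set.insert_sdiff_singleton, Set.insert_eq_of_mem hg]
      exact hG.1.2 q hq))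
  exact (hG.2 ⟨Set.sdiff_subset.trans hG.1.1, hgen⟩ Set.sdiff_subset hg).2 rfl

/-! ### The apices and the classes -/

/-- The half-spaces with apex `α` containing the cone which the direction `D` leaves. -/
def leftBy (v : Fin p → Fin n → ℝ) (α : ProjSpace n) (D : Finset (Fin n)) :
    Set (Set (MaxPlusVec n)) :=
  halfSpaceOf '' {q | q ∈ facets v ∧ q.1 = α ∧ Disjoint q.2 D}

/-- The apices of the half-spaces in non-redundant representations. -/
def apices (v : Fin p → Fin n → ℝ) : Set (ProjSpace n) := {α | ∃ D, IsCritical v α D}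

/-- The classes of exchangeable half-spaces with apex `α` in non-redundant representations. -/
def classes (v : Fin p → Fin n → ℝ) (α : ProjSpace n) : Set (Set (Set (MaxPlusVec n))) :=
  leftBy v α '' {D | Maximal (IsCritical v α) D}

theorem isComposedOfOneInEach_iff {v : Fin p → Fin n → ℝ} (hp : 0 < p)
    {G : Set (ProjSpace n × Finset (Fin n))} (hGv : G ⊆ facets v) :
    IsComposedOfOneInEach (apices v) (classes v) (halfSpaceOf '' G) ↔ IsTransversal v G := by
  have hinj := halfSpaceOf_injOn_facets (v := v) hp
  refine and_congr ?_ ?_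
  · rw [Set.forall_mem_image]
    refine forall₂_congr fun g hg => ⟨?_, ?_⟩
    · rintro ⟨_, -, _, ⟨D, hD, rfl⟩, q, ⟨hq, rfl, hqD⟩, hqg⟩
      obtain rfl := hinj hq (hGv hg) hqg
      exact ⟨D, hD, hqD⟩
    · rintro ⟨D, hD, hgD⟩
      exact ⟨g.1, ⟨D, hD.1⟩, _, ⟨D, hD, rfl⟩, g, ⟨hGv hg, rfl, hgD⟩, rfl⟩
  · have key : ∀ α D, (∃! H, H ∈ halfSpaceOf '' G ∧ H ∈ leftBy v α D) ↔
        ∃! g, g ∈ G ∧ g.1 = α ∧ Disjoint g.2 D := by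
      intro α D
      constructor
      · rintro ⟨_, ⟨⟨g, hg, rfl⟩, q, ⟨hq, hα, hqD⟩, hqg⟩, huniq⟩
        obtain rfl := hinj hq (hGv hg) hqg
        refine ⟨q, ⟨hg, hα, hqD⟩, fun g' ⟨hg', hα', hgD'⟩ => ?_⟩
        exact hinj (hGv hg') hq
          (huniq _ ⟨Set.mem_image_of_mem _ hg', g', ⟨hGv hg', hα', hgD'⟩, rfl⟩)
      · rintro ⟨g, ⟨hg, hα, hgD⟩, huniq⟩
        refine ⟨halfSpaceOf g, ⟨Set.mem_image_of_mem _ hg, g, ⟨hGv hg, hα, hgD⟩, rfl⟩, ?_⟩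
        rintro _ ⟨⟨g', hg', rfl⟩, q, ⟨hq, hα', hqD⟩, hqg⟩
        obtain rfl := hinj hq (hGv hg') hqg
        rw [huniq q ⟨hg', hα', hqD⟩]
    constructor
    · intro h α D hD
      exact (key α D).1 (h α ⟨D, hD.1⟩ _ ⟨D, hD, rfl⟩)
    · rintro h α - _ ⟨D, hD, rfl⟩
      exact (key α D).2 (h α D hD)

theorem leftBy_nonempty {v : Fin p → Fin n → ℝ} {α : ProjSpace n} {D : Finset (Fin n)}
    (hD : IsCritical v α D) : (leftBy v α D).Nonempty :=
  ⟨_, (α, Dᶜ), ⟨hD.mem_facets hD.2.2.1 disjoint_compl_left, rfl, disjoint_compl_left⟩, rfl⟩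

theorem classes_pairwiseDisjoint {v : Fin p → Fin n → ℝ} (hp : 0 < p) (α : ProjSpace n) :
    (classes v α).PairwiseDisjoint id := by
  rintro _ ⟨D, hD, rfl⟩ _ ⟨D', hD', rfl⟩ hne
  refine Set.disjoint_left.2 ?_
  rintro _ ⟨q, ⟨hq, rfl, hqD⟩, rfl⟩ ⟨q', ⟨hq', hα, hqD'⟩, hqq⟩
  obtain rfl := halfSpaceOf_injOn_facets hp hq' hq hqq
  refine hne (congrArg _ (Finset.Subset.antisymm ?_ ?_))
  · exact hD.1.subset_of_maximal hD' hq.2.1 hqD hqD'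
  · exact hD'.1.subset_of_maximal hD hq.2.1 hqD' hqD

theorem mem_image_facets {v : Fin p → Fin n → ℝ} {H : Set (MaxPlusVec n)}
    (hH : IsHalfSpaceWithApexIn (tropicalSpan (fun r => ofReal (v r))) H)
    (hC : tropicalSpan (fun r => ofReal (v r)) ⊆ H) : H ∈ halfSpaceOf '' facets v := by
  obtain ⟨α, hα, hH⟩ := hH
  obtain ⟨I, hI, hIc, rfl⟩ := isHalfSpaceWithApex_iff.1 hH
  exact ⟨(α, I), ⟨mem_projImage_iff.1 hα, (covers_iff hI).1 hC, hIc⟩, rfl⟩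

end TropicalCone

theorem mainTheorem1 (n : ℕ) (C : Set (TropicalCone.MaxPlusVec n))
    (hC : TropicalCone.IsRealPolyhedralCone C) :
    ∃ (A : Set (TropicalCone.ProjSpace n))
      (𝒞 : TropicalCone.ProjSpace n → Set (Set (Set (TropicalCone.MaxPlusVec n)))),
      A ⊆ TropicalCone.projImage C ∧ A.Finite ∧
      (∀ a ∈ A,
        (𝒞 a).Nonempty ∧
        (∀ S ∈ 𝒞 a, S.Nonempty ∧ ∀ H ∈ S, TropicalCone.IsHalfSpaceWithApex H a) ∧
        (𝒞 a).PairwiseDisjoint id) ∧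
      ∀ Γ : Set (Set (TropicalCone.MaxPlusVec n)), Γ.Finite →
        (∀ H ∈ Γ, TropicalCone.IsHalfSpaceWithApexIn C H) →
        (TropicalCone.IsNonRedundantRepresentation C Γ ↔
          TropicalCone.IsComposedOfOneInEach A 𝒞 Γ) := by
  open TropicalCone in
  obtain ⟨p, v, hp, rfl⟩ := hC
  obtain ⟨G₁, hfin, hG₁v, hG₁, hexp⟩ := exists_minimal_isGenerating v
  have hT₁ := hG₁.isTransversal hG₁v hexp
  refine ⟨apices v, classes v, ?_, ?_, ?_, ?_⟩
  · rintro α ⟨D, hD⟩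
    exact mem_projImage_iff.2 hD.1
  · refine (hfin.image Prod.fst).subset ?_
    rintro α ⟨D, hD⟩
    obtain ⟨g, hg, hα, -⟩ := hG₁.exists_disjoint hG₁v hD
    exact ⟨g, hg, hα⟩
  · rintro α ⟨D, hD⟩
    obtain ⟨D', -, hD'⟩ := hD.exists_maximal
    refine ⟨⟨_, D', hD', rfl⟩, ?_, classes_pairwiseDisjoint hp α⟩
    rintro _ ⟨E, hE, rfl⟩
    refine ⟨leftBy_nonempty hE.1, ?_⟩
    rintro _ ⟨⟨β, I⟩, ⟨hq, rfl, -⟩, rfl⟩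
    exact isHalfSpaceWithApex_iff.2 ⟨I, nonempty_of_covers hp hq.2.1, hq.2.2, rfl⟩
  · intro Γ hΓ hapex
    -- Either side of the equivalence forces all members of `Γ` to contain the cone, so it suffices
    -- to treat such families.
    have main : Γ ⊆ halfSpaceOf '' facets v →
        (IsNonRedundantRepresentation (tropicalSpan (fun r => ofReal (v r))) Γ ↔
          IsComposedOfOneInEach (apices v) (classes v) Γ) := by
      intro hsub
      obtain ⟨G, hGv, rfl⟩ := Set.subset_image_iff.1 hsub
      have hG : G.Finite := hΓ.of_finite_image ((halfSpaceOf_injOn_facets hp).mono hGv)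
      rw [isNonRedundantRepresentation_iff hp hG hGv, isComposedOfOneInEach_iff hp hGv]
      exact ⟨fun h => h.1.isTransversal hGv h.2,
        fun h => ⟨h.isGenerating hGv hfin hG₁v hG₁ hT₁.1, h.isExposed hGv⟩⟩
    constructor
    · intro h
      refine (main fun H hH => mem_image_facets (hapex H hH) ?_).1 h
      exact h.1.subset.trans (Set.sInter_subset_of_mem hH)
    · intro h
      refine (main fun H hH => ?_).2 h
      obtain ⟨_, -, _, ⟨D, -, rfl⟩, q, ⟨hq, -, -⟩, rfl⟩ := h.1 H hH
      exact ⟨q, hq, rfl⟩
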